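/- Consider a solution $x_1(t),x_2(t),x_3(t),m_1(t),m_2(t),m_3(t)$ of the three-multipeakon Degasperis–Procesi system $$\dot x_k=u(x_k,t),\qquad \dot m_k=-2\,m_k\,\langle u_x(x_k,t)\rangle\qquad(k=1,2,3),\qquad u(x,t)=\sum_{i=1}^3 m_i(t)\,e^{-|x-x_i(t)|},$$ on a time interval $[0,t_c)$, $0<t_c<\infty$, where $\langle f(x)\rangle=\tfrac12\bigl(f(x^-)+f(x^+)\bigr)$, such that $x_1(t)<x_2(t)<x_3(t)$ for all $t\in[0,t_c)$ and $m_i(0)\neq 0$ for $i=1,2,3$. Let $j\in\{1,2\}$ and suppose that peakon $j$ collides with peakon $j+1$ at the time $t_c$, that is, $x_{j+1}(t)-x_j(t)\to 0$ as $t\to t_c^-$. Then $x_j(t)$ and $x_{j+1}(t)$ converge to a common finite limit $x(t_c)$ as $t\to t_c^-$, the finite limits $$M=\lim_{t\to t_c^-}\bigl(m_j(t)+m_{j+1}(t)\bigr),\qquad s=\lim_{t\to t_c^-}\bigl(u(x_j(t),t)-u(x_{j+1}(t),t)\bigr)$$ exist, $s\neq 0$, and $$\lim_{t\to t_c^-}\bigl(m_j(t)\,\delta_{x_j(t)}+m_{j+1}(t)\,\delta_{x_{j+1}(t)}\bigr)=M\,\delta_{x(t_c)}+\tfrac12\,s\,\delta'_{x(t_c)}\qquad\text{in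 }\mathscr D'(\mathbb R).$$ In particular a shockpeakon (a nonzero $\delta'$ term) is created at the collision. -/

import Mathlib

open Filter Set Topology TopologicalSpace
open scoped Distributions LineDeriv

/-- The peakon superposition `u(y) = ∑ i, m_i * exp (-|y - x_i|)` with positions `x` and
masses `m`. -/
noncomputable def peakonField {n : ℕ} (x m : Fin n → ℝ) (y : ℝ) : ℝ :=
  ∑ i, m i * Real.exp (-|y - x i|)

/-- The average `(u_y(y⁻) + u_y(y⁺)) / 2` of the one-sided derivatives of the peakon superposition,
that is `-∑ i, m_i * sgn (y - x_i) * exp (-|y - x_i|)` with `sgn 0 = 0`. -/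
noncomputable def peakonSlope {n : ℕ} (x m : Fin n → ℝ) (y : ℝ) : ℝ :=
  -∑ i, m i * Real.sign (y - x i) * Real.exp (-|y - x i|)

/-- `x`, `m` are the positions and masses of `n` Degasperis-Procesi multipeakons on the time
interval `[0, T)`: the positions stay in the sector `x_1 < ... < x_n`, and the ordinary differential
equations `x_k' = u(x_k)`, `m_k' = -2 * m_k * ⟨u_y(x_k)⟩` hold (with the one-sided derivative at
the initial time). -/
structure IsDPMultipeakon {n : ℕ} (T : ℝ) (x m : ℝ → Fin n → ℝ) : Prop where
  ordered : ∀ t ∈ Ico 0 T, StrictMono (x t)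
  deriv_position : ∀ t ∈ Ico 0 T, ∀ k : Fin n,
    HasDerivWithinAt (fun τ => x τ k) (peakonField (x t) (m t) (x t k)) (Ico 0 T) t
  deriv_mass : ∀ t ∈ Ico 0 T, ∀ k : Fin n,
    HasDerivWithinAt (fun τ => m τ k) (-2 * m t k * peakonSlope (x t) (m t) (x t k)) (Ico 0 T) t

/-- The Dirac distribution at the point `a` of the real line, as an element of `𝓓'(ℝ)`. -/
noncomputable abbrev diracDelta (a : ℝ) : 𝓓'((⊤ : Opens ℝ), ℝ) := Distribution.delta a

/-! The two colliding masses blow up, so limits are first taken of the values z_k = u(x_k). The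
nonlocal form u_t + u u_x = -∂_x(p * (3/2) u²), with p = exp(-|x|)/2, makes each z_k' an integral of
u² against a kernel bounded by 3/4. The conserved `dpEnergy` is a multiple of ∫ (1+ξ²)/(4+ξ²) |û|²
dξ, hence comparable to ∫ u². So the z_k are Lipschitz and converge, and then so do the x_k
(`exists_bound_and_tendsto_z`).

The masses are recovered linearly, for instance z₁ - a z₂ = m₁ (1 - a²). The cubic invariant,
nonzero because no initial mass vanishes, is a product of three convergent quantities, so no factor
tends to 0. This excludes a triple collision and gives s ≠ 0 (`mass_asymptotics_of_collision`).
Since 1 - a is asymptotic to the gap, the dipole moment of the pair tends to s/2, and a Taylor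
estimate yields the δ' term (`tendsto_smul_diracDelta_add`). -/

/-! ### Coercivity of the energy -/

/-- The conserved energy of three Degasperis-Procesi peakons with masses `m₁, m₂, m₃`, in terms
of `a = exp (x₁ - x₂)` and `b = exp (x₂ - x₃)`. -/
def dpEnergy (m₁ m₂ m₃ a b : ℝ) : ℝ :=
  m₁ ^ 2 + m₂ ^ 2 + m₃ ^ 2 + 2 * m₁ * m₂ * (2 * a - a ^ 2) + 2 * m₂ * m₃ * (2 * b - b ^ 2) +
    2 * m₁ * m₃ * (2 * (a * b) - (a * b) ^ 2)

theorem dpEnergy_reverse (m₁ m₂ m₃ a b : ℝ) :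
    dpEnergy m₃ m₂ m₁ b a = dpEnergy m₁ m₂ m₃ a b := by
  unfold dpEnergy; ring

/-- The right side is 12 ∫ (A e^{-s} - B e^{-2s})² ds over 0 < s < -log b; completing the square in
B leaves the multiple of A². -/
theorem le_energy_middle {b : ℝ} (hb : 0 < b) (hb1 : b < 1) (A B : ℝ) :
    2 / 3 * (1 - b) ^ 3 * A ^ 2 ≤
      6 * A ^ 2 * (1 - b ^ 2) - 8 * A * B * (1 - b ^ 3) + 3 * B ^ 2 * (1 - b ^ 4) := by
  have hw : 0 < 3 * ((1 + b) * (1 + b ^ 2)) := by positivity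
  have h1b : 0 < 1 - b := by linarith
  rw [← sub_nonneg]
  have key : 3 * ((1 + b) * (1 + b ^ 2)) *
      (6 * A ^ 2 * (1 - b ^ 2) - 8 * A * B * (1 - b ^ 3) + 3 * B ^ 2 * (1 - b ^ 4) -
        2 / 3 * (1 - b) ^ 3 * A ^ 2) =
      (1 - b) * (3 * ((1 + b) * (1 + b ^ 2)) * B - 4 * (1 + b + b ^ 2) * A) ^ 2 +
      2 * (1 - b) ^ 3 * A ^ 2 * (b * (3 - b ^ 2)) := by ring
  have h3 : 0 ≤ 3 - b ^ 2 := by nlinarith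
  have : 0 ≤ 3 * ((1 + b) * (1 + b ^ 2)) *
      (6 * A ^ 2 * (1 - b ^ 2) - 8 * A * B * (1 - b ^ 3) + 3 * B ^ 2 * (1 - b ^ 4) -
        2 / 3 * (1 - b) ^ 3 * A ^ 2) := by
    rw [key]; positivity
  exact nonneg_of_mul_nonneg_right this hw

theorem dpEnergy_lower_bounds (m₁ m₂ m₃ : ℝ) {a b : ℝ} (ha : 0 < a) (ha1 : a < 1) (hb : 0 < b)
    (hb1 : b < 1) :
    (m₁ * a * b + m₂ * b + m₃) ^ 2 ≤ 3 / 2 * dpEnergy m₁ m₂ m₃ a b ∧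
      (1 - b) * (m₁ * a + m₂ + m₃ * b) ^ 2 ≤ 12 * dpEnergy m₁ m₂ m₃ a b := by
  set z₃ := m₁ * a * b + m₂ * b + m₃ with hz₃
  set A := m₂ + m₁ * a with hA
  set B := m₂ + m₁ * a ^ 2 with hB
  set E := m₃ + m₂ * b ^ 2 + m₁ * a ^ 2 * b ^ 2 with hE
  -- The energy is 12 ∫ w² with w(y) = ∑ m_i φ(y - x_i), where φ(s) = e^{-s} - e^{-2s} for s > 0 and
  -- 0 otherwise. The three summands are the integrals over (x₁, x₂), (x₂, x₃) and (x₃, ∞).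
  have split : dpEnergy m₁ m₂ m₃ a b = m₁ ^ 2 * (1 - a) ^ 3 * (1 + 3 * a) +
      (6 * A ^ 2 * (1 - b ^ 2) - 8 * A * B * (1 - b ^ 3) + 3 * B ^ 2 * (1 - b ^ 4)) +
      (2 / 3 * z₃ ^ 2 + 3 * (E - 4 / 3 * z₃) ^ 2) := by
    rw [hz₃, hA, hB, hE]; unfold dpEnergy; ring
  clear_value z₃ A B E
  have h1a : 0 < 1 - a := by linarith
  have h1b : 0 < 1 - b := by linarith
  have hmid := le_energy_middle hb hb1 A B
  have hleft : 0 ≤ m₁ ^ 2 * (1 - a) ^ 3 * (1 + 3 * a) := by positivity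
  have hsq : 0 ≤ 3 * (E - 4 / 3 * z₃) ^ 2 := by positivity
  have hmid0 : 0 ≤ 2 / 3 * (1 - b) ^ 3 * A ^ 2 := by positivity
  refine ⟨by linarith, ?_⟩
  have hz₂ : m₁ * a + m₂ + m₃ * b = A * (1 - b ^ 2) + b * z₃ := by rw [hz₃, hA]; ring
  rw [hz₂]
  clear hz₂
  have h1 : (A * (1 - b ^ 2) + b * z₃) ^ 2 ≤ 2 * (A * (1 - b ^ 2)) ^ 2 + 2 * (b * z₃) ^ 2 := by
    nlinarith [sq_nonneg (A * (1 - b ^ 2) - b * z₃)]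
  have h2 : (1 - b) * (b * z₃) ^ 2 ≤ z₃ ^ 2 := by
    have : (1 - b) * b ^ 2 ≤ 1 := by nlinarith [sq_nonneg b]
    calc (1 - b) * (b * z₃) ^ 2 = (1 - b) * b ^ 2 * z₃ ^ 2 := by ring
      _ ≤ 1 * z₃ ^ 2 := by gcongr
      _ = z₃ ^ 2 := one_mul _
  have h3 : (1 - b) * (A * (1 - b ^ 2)) ^ 2 ≤ 4 * ((1 - b) ^ 3 * A ^ 2) := by
    have : (1 + b) ^ 2 ≤ 4 := by nlinarith
    calc (1 - b) * (A * (1 - b ^ 2)) ^ 2 = (1 + b) ^ 2 * ((1 - b) ^ 3 * A ^ 2) := by ring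
      _ ≤ 4 * ((1 - b) ^ 3 * A ^ 2) := by gcongr
  have h4 := mul_le_mul_of_nonneg_left h1 h1b.le
  rw [mul_add, mul_left_comm, mul_left_comm (1 - b)] at h4
  linarith [sq_nonneg z₃]

/-- The integral of `exp (-|y - x|) * u y ^ 2` over the interval between two consecutive peakons,
where `x` is one of the end points, `a = exp (-length)`, and `z`, `w` are the values of `u` at
`x` and at the other end point. -/
noncomputable def weightedSqIntegral (a z w : ℝ) : ℝ :=
  (1 - a) / (3 * (1 + a) ^ 2) * ((1 + 3 * a) * z ^ 2 + 4 * a * (z * w) + a * (3 + a) * w ^ 2)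

theorem abs_weightedSqIntegral_le {a : ℝ} (ha : 0 < a) (ha1 : a < 1) (z w : ℝ) :
    |weightedSqIntegral a z w| ≤ 2 * ((1 - a) * z ^ 2 + (1 - a) * w ^ 2) := by
  have h1a : 0 < 1 - a := by linarith
  have hq : |(1 + 3 * a) * z ^ 2 + 4 * a * (z * w) + a * (3 + a) * w ^ 2| ≤
      6 * (z ^ 2 + w ^ 2) := by
    have e1 : 0 ≤ a * (z + w) ^ 2 := by positivity
    have e2 : 0 ≤ a * (z - w) ^ 2 := by positivity
    have e3 : a * z ^ 2 ≤ z ^ 2 := by nlinarith [sq_nonneg z]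
    have e4 : a * w ^ 2 ≤ w ^ 2 := by nlinarith [sq_nonneg w]
    have e5 : a ^ 2 * w ^ 2 ≤ w ^ 2 := by
      have : a ^ 2 ≤ 1 := by nlinarith
      nlinarith [sq_nonneg w]
    have e6 : 0 ≤ a ^ 2 * w ^ 2 := by positivity
    have e7 : 0 ≤ a * z ^ 2 := by positivity
    have e8 : 0 ≤ a * w ^ 2 := by positivity
    rw [abs_le]
    constructor <;> nlinarith [sq_nonneg z, sq_nonneg w]
  have hd : 1 ≤ (1 + a) ^ 2 := by nlinarith
  unfold weightedSqIntegral
  rw [abs_mul, abs_of_nonneg (by positivity)]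
  calc (1 - a) / (3 * (1 + a) ^ 2) * _ ≤ (1 - a) / (3 * 1) * (6 * (z ^ 2 + w ^ 2)) := by
        gcongr
    _ = _ := by ring

/-- These combinations are the signed integrals of exp(-|y - x_k|) u² that drive z_k'. The energy
controls z₁² and z₃² outright, but z₂² only with weight 1 - a or 1 - b; the factor 1 - a in
`weightedSqIntegral` supplies that weight. -/
theorem abs_le_dpEnergy (m₁ m₂ m₃ : ℝ) {a b : ℝ} (ha : 0 < a) (ha1 : a < 1) (hb : 0 < b)
    (hb1 : b < 1) {z₁ z₂ z₃ : ℝ} (hz₁ : z₁ = m₁ + m₂ * a + m₃ * (a * b))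
    (hz₂ : z₂ = m₁ * a + m₂ + m₃ * b) (hz₃ : z₃ = m₁ * (a * b) + m₂ * b + m₃) :
    |weightedSqIntegral a z₁ z₂ + a * weightedSqIntegral b z₂ z₃ + a * b * z₃ ^ 2 / 3
        - z₁ ^ 2 / 3| ≤ 100 * dpEnergy m₁ m₂ m₃ a b ∧
    |weightedSqIntegral b z₂ z₃ + b * z₃ ^ 2 / 3 - weightedSqIntegral a z₂ z₁
        - a * z₁ ^ 2 / 3| ≤ 100 * dpEnergy m₁ m₂ m₃ a b ∧
    |z₃ ^ 2 / 3 - weightedSqIntegral b z₃ z₂ - b * weightedSqIntegral a z₂ z₁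
        - a * b * z₁ ^ 2 / 3| ≤ 100 * dpEnergy m₁ m₂ m₃ a b := by
  have hab : a * b < 1 := mul_lt_one_of_nonneg_of_lt_one_left ha.le ha1 hb1.le
  obtain ⟨e3, e2b⟩ := dpEnergy_lower_bounds m₁ m₂ m₃ ha ha1 hb hb1
  obtain ⟨e1, e2a⟩ := dpEnergy_lower_bounds m₃ m₂ m₁ hb hb1 ha ha1
  rw [dpEnergy_reverse] at e1 e2a
  rw [show m₁ * a * b + m₂ * b + m₃ = z₃ by rw [hz₃]; ring] at e3
  rw [show m₃ * b * a + m₂ * a + m₁ = z₁ by rw [hz₁]; ring] at e1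
  rw [show m₁ * a + m₂ + m₃ * b = z₂ by rw [hz₂]] at e2b
  rw [show m₃ * b + m₂ + m₁ * a = z₂ by rw [hz₂]; ring] at e2a
  clear hz₁ hz₂ hz₃
  generalize dpEnergy m₁ m₂ m₃ a b = H at *
  have q1 := sq_nonneg z₁
  have q3 := sq_nonneg z₃
  have r1 : (1 - a) * z₁ ^ 2 ≤ z₁ ^ 2 := by nlinarith
  have r3 : (1 - b) * z₃ ^ 2 ≤ z₃ ^ 2 := by nlinarith
  have hA : ∀ {c z w : ℝ}, 0 < c → c < 1 → (1 - c) * z ^ 2 ≤ 12 * H → (1 - c) * w ^ 2 ≤ 12 * H →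
      |weightedSqIntegral c z w| ≤ 48 * H := fun {c z w} hc hc1 h1 h2 => by
    have := abs_weightedSqIntegral_le hc hc1 z w
    linarith
  have hs : ∀ {c w B : ℝ}, 0 ≤ c → c ≤ 1 → |w| ≤ B → |c * w| ≤ B := fun {c w B} hc hc1 h => by
    rw [abs_mul, abs_of_nonneg hc]
    nlinarith [abs_nonneg w]
  have hH : 0 ≤ H := by linarith
  have i1 := hA ha ha1 (z := z₁) (w := z₂) (by linarith) e2a
  have i1' := hA ha ha1 (z := z₂) (w := z₁) e2a (by linarith)
  have i2 := hA hb hb1 (z := z₂) (w := z₃) e2b (by linarith)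
  have i2' := hA hb hb1 (z := z₃) (w := z₂) (by linarith) e2b
  have i3 := hs ha.le ha1.le i2
  have i4 := hs hb.le hb1.le i1'
  have s1 : |z₁ ^ 2 / 3| ≤ H := by rw [abs_of_nonneg (by positivity)]; linarith
  have s3 : |z₃ ^ 2 / 3| ≤ H := by rw [abs_of_nonneg (by positivity)]; linarith
  have t1 := hs (mul_pos ha hb).le hab.le s1
  have t3 := hs (mul_pos ha hb).le hab.le s3
  have t4 := hs ha.le ha1.le s1
  have t5 := hs hb.le hb1.le s3
  rw [← mul_div_assoc] at t1 t3 t4 t5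
  simp only [abs_le] at *
  refine ⟨⟨?_, ?_⟩, ⟨?_, ?_⟩, ⟨?_, ?_⟩⟩ <;> linarith

/-! ### Merging point masses as distributions -/

theorem TestFunction.hasDerivAt_lineDeriv (f : 𝓓((⊤ : Opens ℝ), ℝ)) (x : ℝ) :
    HasDerivAt f ((∂_{(1 : ℝ)} f : 𝓓((⊤ : Opens ℝ), ℝ)) x) x := by
  have h1 : DifferentiableAt ℝ f x := f.contDiff.differentiable (by simp) x
  have h2 : (∂_{(1 : ℝ)} f : 𝓓((⊤ : Opens ℝ), ℝ)) x = deriv f x := by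
    rw [TestFunction.lineDerivOp_eq_lineDerivCLM ℝ, TestFunction.lineDerivCLM_apply_of_le (𝕜 := ℝ) (by simp)]
    exact h1.lineDeriv_eq_fderiv.trans (by simp)
  rw [h2]
  exact h1.hasDerivAt

theorem TestFunction.exists_bound_of_isCompact {S : Set 𝓓((⊤ : Opens ℝ), ℝ)} (hS : IsCompact S) :
    ∃ C, 0 ≤ C ∧ ∀ f ∈ S, ∀ x, |f x| ≤ C := by
  have hc : Continuous fun f : 𝓓((⊤ : Opens ℝ), ℝ) =>
      ‖TestFunction.toBoundedContinuousFunctionCLM ℝ f‖ :=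
    (ContinuousLinearMap.continuous _).norm
  obtain ⟨C, hC⟩ := (hS.image hc).bddAbove
  refine ⟨max C 0, le_max_right _ _, fun f hf x => le_max_of_le_left ?_⟩
  exact ((TestFunction.toBoundedContinuousFunctionCLM ℝ f).norm_coe_le_norm x).trans
    (hC (mem_image_of_mem _ hf))

/-- A uniform bound for a difference quotient-like pairing with a test function whose values and
first two derivatives are bounded by `C`. -/
theorem abs_dipole_sub_le {f f' f'' : ℝ → ℝ} {C : ℝ} (h1 : ∀ x, HasDerivAt f (f' x) x)
    (h2 : ∀ x, HasDerivAt f' (f'' x) x) (b0 : ∀ x, |f x| ≤ C) (b1 : ∀ x, |f' x| ≤ C)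
    (b2 : ∀ x, |f'' x| ≤ C) (μ ν y w c M σ : ℝ) :
    |μ * f y + ν * f w - (M * f c - σ * f' c)| ≤
      C * (|μ * (w - y) - σ| + |μ * (w - y)| * (|y - c| + |w - c|) + |μ + ν| * |w - c| +
        |μ + ν - M|) := by
  have hC : 0 ≤ C := (abs_nonneg _).trans (b0 0)
  have lip : ∀ {g g' : ℝ → ℝ}, (∀ x, HasDerivAt g (g' x) x) → (∀ x, |g' x| ≤ C) →
      ∀ p q, |g q - g p| ≤ C * |q - p| := fun hg hb p q => by
    simpa using convex_univ.norm_image_sub_le_of_norm_hasDerivWithin_le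
      (fun x _ => (hg x).hasDerivWithinAt) (fun x _ => hb x) (mem_univ p) (mem_univ q)
  -- Removing the slope at c gains a factor tending to 0 beyond |y - w|; this is needed because only
  -- μ (w - y), not μ, stays bounded.
  have hR : |(f y - f' c * y) - (f w - f' c * w)| ≤ C * (|y - c| + |w - c|) * |y - w| := by
    refine (convex_uIcc w y).norm_image_sub_le_of_norm_hasDerivWithin_le
      (f := fun x => f x - f' c * x) (f' := fun x => f' x - f' c * 1)
      (fun x _ => ((h1 x).sub ((hasDerivAt_id x).const_mul _)).hasDerivWithinAt) ?_
      left_mem_uIcc right_mem_uIcc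
    intro x hx
    rw [mul_one]
    refine (lip h2 b2 c x).trans (mul_le_mul_of_nonneg_left ?_ hC)
    rcases le_total w y with hwy | hwy
    · rw [uIcc_of_le hwy] at hx
      rcases abs_cases (x - c) with h | h <;> rcases abs_cases (y - c) with h' | h' <;>
        rcases abs_cases (w - c) with h'' | h'' <;> linarith [hx.1, hx.2]
    · rw [uIcc_of_ge hwy] at hx
      rcases abs_cases (x - c) with h | h <;> rcases abs_cases (y - c) with h' | h' <;>
        rcases abs_cases (w - c) with h'' | h'' <;> linarith [hx.1, hx.2]
  have e : μ * f y + ν * f w - (M * f c - σ * f' c) =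
      -((μ * (w - y) - σ) * f' c) + μ * ((f y - f' c * y) - (f w - f' c * w)) +
        (μ + ν) * (f w - f c) + (μ + ν - M) * f c := by ring
  rw [e]
  have t1 : |-((μ * (w - y) - σ) * f' c)| ≤ C * |μ * (w - y) - σ| := by
    rw [abs_neg, abs_mul, mul_comm]
    exact mul_le_mul_of_nonneg_right (b1 c) (abs_nonneg _)
  have t2 : |μ * ((f y - f' c * y) - (f w - f' c * w))| ≤
      C * (|μ * (w - y)| * (|y - c| + |w - c|)) := by
    rw [abs_mul, abs_mul μ, abs_sub_comm w y]
    calc _ ≤ |μ| * (C * (|y - c| + |w - c|) * |y - w|) := by gcongr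
      _ = _ := by ring
  have t3 : |(μ + ν) * (f w - f c)| ≤ C * (|μ + ν| * |w - c|) := by
    rw [abs_mul]
    calc _ ≤ |μ + ν| * (C * |w - c|) := by gcongr; exact lip h1 b1 c w
      _ = _ := by ring
  have t4 : |(μ + ν - M) * f c| ≤ C * |μ + ν - M| := by
    rw [abs_mul, mul_comm]
    exact mul_le_mul_of_nonneg_right (b0 c) (abs_nonneg _)
  refine (abs_add_le _ _).trans ?_
  have := abs_add_three (-((μ * (w - y) - σ) * f' c))
    (μ * ((f y - f' c * y) - (f w - f' c * w))) ((μ + ν) * (f w - f c))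
  nlinarith

/-- Two merging point masses, whose total mass and dipole moment converge, converge in `𝓓'(ℝ)` to a
point mass plus a multiple of the derivative of the Dirac distribution. -/
theorem tendsto_smul_diracDelta_add {ι : Type*} {l : Filter ι} {μ ν y w : ι → ℝ} {c M σ : ℝ}
    (hy : Tendsto y l (𝓝 c)) (hw : Tendsto w l (𝓝 c))
    (hM : Tendsto (fun t => μ t + ν t) l (𝓝 M))
    (hσ : Tendsto (fun t => μ t * (w t - y t)) l (𝓝 σ)) :
    Tendsto (fun t => μ t • diracDelta (y t) + ν t • diracDelta (w t)) l
      (𝓝 (M • diracDelta c + σ • ∂_{(1 : ℝ)} (diracDelta c))) := by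
  -- Convergence here is uniform on compact sets of test functions, so the Taylor bound needs one
  -- constant for each such set.
  rw [← tendsto_sub_nhds_zero_iff, CompactConvergenceCLM.hasBasis_nhds_zero.tendsto_right_iff]
  rintro ⟨S, V⟩ ⟨hS, hV⟩
  let D : 𝓓((⊤ : Opens ℝ), ℝ) → 𝓓((⊤ : Opens ℝ), ℝ) := fun f => ∂_{(1 : ℝ)} f
  have hD : Continuous D := LineDeriv.continuous_lineDerivOp (1 : ℝ)
  obtain ⟨C₀, hC₀, b0⟩ := TestFunction.exists_bound_of_isCompact hS
  obtain ⟨C₁, hC₁, b1⟩ := TestFunction.exists_bound_of_isCompact (hS.image hD)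
  obtain ⟨C₂, hC₂, b2⟩ := TestFunction.exists_bound_of_isCompact ((hS.image hD).image hD)
  set C := C₀ + C₁ + C₂ with hCdef
  have hlim : Tendsto (fun t => C * (|μ t * (w t - y t) - σ| +
      |μ t * (w t - y t)| * (|y t - c| + |w t - c|) + |μ t + ν t| * |w t - c| +
        |μ t + ν t - M|)) l (𝓝 0) := by
    have h := (((((hσ.sub_const σ).abs).add (hσ.abs.mul ((hy.sub_const c).abs.add
      (hw.sub_const c).abs))).add (hM.abs.mul (hw.sub_const c).abs)).add
      (hM.sub_const M).abs).const_mul C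
    simpa using h
  obtain ⟨ε, hε, hεV⟩ := Metric.mem_nhds_iff.1 hV
  filter_upwards [hlim.eventually (gt_mem_nhds hε)] with t ht f hf
  apply hεV
  rw [mem_ball_zero_iff, Real.norm_eq_abs]
  refine lt_of_le_of_lt ?_ ht
  have := abs_dipole_sub_le (C := C) (TestFunction.hasDerivAt_lineDeriv f)
    (TestFunction.hasDerivAt_lineDeriv (D f))
    (fun x => (b0 f hf x).trans (by linarith))
    (fun x => (b1 _ (mem_image_of_mem D hf) x).trans (by linarith))
    (fun x => (b2 _ (mem_image_of_mem D (mem_image_of_mem D hf)) x).trans (by linarith))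
    (μ t) (ν t) (y t) (w t) c M σ
  have e : (∂_{(1 : ℝ)} (diracDelta c)) f = -((∂_{(1 : ℝ)} f : 𝓓((⊤ : Opens ℝ), ℝ)) c) := by
    rw [Distribution.lineDerivOp_apply_apply]; rfl
  change |μ t * f (y t) + ν t * f (w t) - (M * f c + σ * (∂_{(1 : ℝ)} (diracDelta c)) f)| ≤ _
  rw [e]
  convert this using 2
  change _ = μ t * f (y t) + ν t * f (w t) - (M * f c - σ * D f c)
  ring

/-! ### Reduction to masses and exponentials of gaps -/

theorem peakonField_fin_three {x m : Fin 3 → ℝ} (hx : StrictMono x) {a b : ℝ}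
    (ha : a = Real.exp (x 0 - x 1)) (hb : b = Real.exp (x 1 - x 2)) :
    peakonField x m (x 0) = m 0 + m 1 * a + m 2 * (a * b) ∧
      peakonField x m (x 1) = m 0 * a + m 1 + m 2 * b ∧
      peakonField x m (x 2) = m 0 * (a * b) + m 1 * b + m 2 := by
  have h01 : x 0 < x 1 := hx (by decide)
  have h12 : x 1 < x 2 := hx (by decide)
  have hab : a * b = Real.exp (x 0 - x 2) := by rw [ha, hb, ← Real.exp_add]; ring_nf
  rw [hab, ha, hb]
  refine ⟨?_, ?_, ?_⟩ <;> simp only [peakonField, Fin.sum_univ_three, sub_self, abs_zero, neg_zero,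
    Real.exp_zero, mul_one]
  · rw [abs_of_neg (by linarith : x 0 - x 1 < 0), abs_of_neg (by linarith : x 0 - x 2 < 0)]
    simp only [neg_neg]
  · rw [abs_of_pos (by linarith : 0 < x 1 - x 0), abs_of_neg (by linarith : x 1 - x 2 < 0)]
    simp only [neg_sub]
  · rw [abs_of_pos (by linarith : 0 < x 2 - x 0), abs_of_pos (by linarith : 0 < x 2 - x 1)]
    simp only [neg_sub]

theorem peakonSlope_fin_three {x m : Fin 3 → ℝ} (hx : StrictMono x) {a b : ℝ}
    (ha : a = Real.exp (x 0 - x 1)) (hb : b = Real.exp (x 1 - x 2)) :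
    peakonSlope x m (x 0) = m 1 * a + m 2 * (a * b) ∧
      peakonSlope x m (x 1) = m 2 * b - m 0 * a ∧
      peakonSlope x m (x 2) = -(m 0 * (a * b)) - m 1 * b := by
  have h01 : x 0 < x 1 := hx (by decide)
  have h12 : x 1 < x 2 := hx (by decide)
  have hab : a * b = Real.exp (x 0 - x 2) := by rw [ha, hb, ← Real.exp_add]; ring_nf
  rw [hab, ha, hb]
  refine ⟨?_, ?_, ?_⟩ <;> simp only [peakonSlope, Fin.sum_univ_three, sub_self, Real.sign_zero]
  · rw [abs_of_neg (by linarith : x 0 - x 1 < 0), abs_of_neg (by linarith : x 0 - x 2 < 0),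
      Real.sign_of_neg (by linarith : x 0 - x 1 < 0), Real.sign_of_neg (by linarith : x 0 - x 2 < 0)]
    simp only [neg_neg]
    ring
  · rw [abs_of_pos (by linarith : 0 < x 1 - x 0), abs_of_neg (by linarith : x 1 - x 2 < 0),
      Real.sign_of_pos (by linarith : 0 < x 1 - x 0), Real.sign_of_neg (by linarith : x 1 - x 2 < 0)]
    simp only [neg_sub]
    ring
  · rw [abs_of_pos (by linarith : 0 < x 2 - x 0), abs_of_pos (by linarith : 0 < x 2 - x 1),
      Real.sign_of_pos (by linarith : 0 < x 2 - x 0), Real.sign_of_pos (by linarith : 0 < x 2 - x 1)]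
    simp only [neg_sub]
    ring

/-- The reduced system for the masses of three ordered Degasperis-Procesi peakons and for
`a = exp (x₁ - x₂)`, `b = exp (x₂ - x₃)`, with `z₁, z₂, z₃` the values of `u` at the peakons. -/
structure IsReducedDP (T : ℝ) (m₁ m₂ m₃ a b z₁ z₂ z₃ : ℝ → ℝ) : Prop where
  a_mem : ∀ t ∈ Ico 0 T, a t ∈ Ioo 0 1
  b_mem : ∀ t ∈ Ico 0 T, b t ∈ Ioo 0 1
  z₁_eq : ∀ t ∈ Ico 0 T, z₁ t = m₁ t + m₂ t * a t + m₃ t * (a t * b t)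
  z₂_eq : ∀ t ∈ Ico 0 T, z₂ t = m₁ t * a t + m₂ t + m₃ t * b t
  z₃_eq : ∀ t ∈ Ico 0 T, z₃ t = m₁ t * (a t * b t) + m₂ t * b t + m₃ t
  deriv_m₁ : ∀ t ∈ Ico 0 T,
    HasDerivWithinAt m₁ (-2 * m₁ t * (m₂ t * a t + m₃ t * (a t * b t))) (Ico 0 T) t
  deriv_m₂ : ∀ t ∈ Ico 0 T,
    HasDerivWithinAt m₂ (-2 * m₂ t * (m₃ t * b t - m₁ t * a t)) (Ico 0 T) t
  deriv_m₃ : ∀ t ∈ Ico 0 T,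
    HasDerivWithinAt m₃ (-2 * m₃ t * (-(m₁ t * (a t * b t)) - m₂ t * b t)) (Ico 0 T) t
  deriv_a : ∀ t ∈ Ico 0 T, HasDerivWithinAt a (a t * (z₁ t - z₂ t)) (Ico 0 T) t
  deriv_b : ∀ t ∈ Ico 0 T, HasDerivWithinAt b (b t * (z₂ t - z₃ t)) (Ico 0 T) t

theorem IsDPMultipeakon.isReducedDP {T : ℝ} {x m : ℝ → Fin 3 → ℝ} (h : IsDPMultipeakon T x m) :
    IsReducedDP T (fun t => m t 0) (fun t => m t 1) (fun t => m t 2)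
      (fun t => Real.exp (x t 0 - x t 1)) (fun t => Real.exp (x t 1 - x t 2))
      (fun t => peakonField (x t) (m t) (x t 0)) (fun t => peakonField (x t) (m t) (x t 1))
      (fun t => peakonField (x t) (m t) (x t 2)) where
  a_mem t ht := ⟨Real.exp_pos _, Real.exp_lt_one_iff.2 (sub_neg.2 (h.ordered t ht (by decide)))⟩
  b_mem t ht := ⟨Real.exp_pos _, Real.exp_lt_one_iff.2 (sub_neg.2 (h.ordered t ht (by decide)))⟩
  z₁_eq t ht := (peakonField_fin_three (h.ordered t ht) rfl rfl).1
  z₂_eq t ht := (peakonField_fin_three (h.ordered t ht) rfl rfl).2.1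
  z₃_eq t ht := (peakonField_fin_three (h.ordered t ht) rfl rfl).2.2
  deriv_m₁ t ht := by
    have := h.deriv_mass t ht 0
    rwa [(peakonSlope_fin_three (h.ordered t ht) rfl rfl).1] at this
  deriv_m₂ t ht := by
    have := h.deriv_mass t ht 1
    rwa [(peakonSlope_fin_three (h.ordered t ht) rfl rfl).2.1] at this
  deriv_m₃ t ht := by
    have := h.deriv_mass t ht 2
    rwa [(peakonSlope_fin_three (h.ordered t ht) rfl rfl).2.2] at this
  deriv_a t ht := ((h.deriv_position t ht 0).sub (h.deriv_position t ht 1)).exp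
  deriv_b t ht := ((h.deriv_position t ht 1).sub (h.deriv_position t ht 2)).exp

/-! ### Conservation laws and limits of the peakon velocities -/

theorem eq_of_hasDerivWithinAt_Ico_zero {T : ℝ} {f : ℝ → ℝ}
    (hf : ∀ t ∈ Ico 0 T, HasDerivWithinAt f 0 (Ico 0 T) t) {t : ℝ} (ht : t ∈ Ico 0 T) :
    f t = f 0 := by
  have := (convex_Ico 0 T).norm_image_sub_le_of_norm_hasDerivWithin_le (C := 0) hf
    (fun _ _ => by simp) ⟨le_rfl, ht.1.trans_lt ht.2⟩ ht
  rw [zero_mul, norm_le_zero_iff] at this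
  linarith

theorem exists_bound_and_tendsto_of_abs_deriv_le {T C : ℝ} (hT : 0 < T) {f f' : ℝ → ℝ}
    (hf : ∀ t ∈ Ico 0 T, HasDerivWithinAt f (f' t) (Ico 0 T) t)
    (hC : ∀ t ∈ Ico 0 T, |f' t| ≤ C) :
    (∃ B, ∀ t ∈ Ico 0 T, |f t| ≤ B) ∧ ∃ l, Tendsto f (𝓝[<] T) (𝓝 l) := by
  have hlip : LipschitzOnWith C.toNNReal f (Ico 0 T) :=
    (convex_Ico 0 T).lipschitzOnWith_of_nnnorm_hasDerivWithin_le hf fun t ht => by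
      rw [← NNReal.coe_le_coe, coe_nnnorm]
      exact (hC t ht).trans (Real.le_coe_toNNReal C)
  -- A Lipschitz extension to the whole line is continuous at T and bounded on [0, T], which gives
  -- both claims.
  obtain ⟨g, hg, hfg⟩ := hlip.extend_real
  constructor
  · obtain ⟨B, hB⟩ := (isCompact_Icc (a := 0) (b := T)).exists_bound_of_continuousOn
      hg.continuous.continuousOn
    exact ⟨B, fun t ht => by rw [hfg ht]; exact hB t (Ico_subset_Icc_self ht)⟩
  refine ⟨g T, ((hg.continuous.tendsto T).mono_left nhdsWithin_le_nhds).congr' ?_⟩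
  filter_upwards [Ico_mem_nhdsLT hT] with t ht using (hfg ht).symm

namespace IsReducedDP

variable {T : ℝ} {m₁ m₂ m₃ a b z₁ z₂ z₃ : ℝ → ℝ}

/-- This is z_k' = (3/4) ∫ sgn(x_k - y) exp(-|x_k - y|) u² dy, split at the peakons; the terms z²/3
come from the two exponential tails. -/
theorem deriv_z (h : IsReducedDP T m₁ m₂ m₃ a b z₁ z₂ z₃) {t : ℝ} (ht : t ∈ Ico 0 T) :
    HasDerivWithinAt z₁ (-(3 / 4) * (weightedSqIntegral (a t) (z₁ t) (z₂ t) +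
      a t * weightedSqIntegral (b t) (z₂ t) (z₃ t) + a t * b t * z₃ t ^ 2 / 3
        - z₁ t ^ 2 / 3)) (Ico 0 T) t ∧
    HasDerivWithinAt z₂ (-(3 / 4) * (weightedSqIntegral (b t) (z₂ t) (z₃ t) +
      b t * z₃ t ^ 2 / 3 - weightedSqIntegral (a t) (z₂ t) (z₁ t)
        - a t * z₁ t ^ 2 / 3)) (Ico 0 T) t ∧
    HasDerivWithinAt z₃ (-(3 / 4) * (z₃ t ^ 2 / 3 - weightedSqIntegral (b t) (z₃ t) (z₂ t) -
      b t * weightedSqIntegral (a t) (z₂ t) (z₁ t) - a t * b t * z₁ t ^ 2 / 3)) (Ico 0 T) t := by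
  have ha : 1 + a t ≠ 0 := by linarith [(h.a_mem t ht).1]
  have hb : 1 + b t ≠ 0 := by linarith [(h.b_mem t ht).1]
  have e₁ := h.z₁_eq t ht
  have e₂ := h.z₂_eq t ht
  have e₃ := h.z₃_eq t ht
  have d₁ := h.deriv_m₁ t ht
  have d₂ := h.deriv_m₂ t ht
  have d₃ := h.deriv_m₃ t ht
  have da := h.deriv_a t ht
  have db := h.deriv_b t ht
  refine ⟨?_, ?_, ?_⟩
  · have := ((d₁.add (d₂.mul da)).add (d₃.mul (da.mul db)))
    refine (this.congr (fun s hs => h.z₁_eq s hs) (h.z₁_eq t ht)).congr_deriv ?_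
    simp only [Pi.mul_apply, weightedSqIntegral]
    rw [e₁, e₂, e₃]
    generalize a t = a at *
    generalize b t = b at *
    field_simp
    ring
  · have := (((d₁.mul da).add d₂).add (d₃.mul db))
    refine (this.congr (fun s hs => h.z₂_eq s hs) (h.z₂_eq t ht)).congr_deriv ?_
    simp only [weightedSqIntegral]
    rw [e₁, e₂, e₃]
    generalize a t = a at *
    generalize b t = b at *
    field_simp
    ring
  · have := (((d₁.mul (da.mul db)).add (d₂.mul db)).add d₃)
    refine (this.congr (fun s hs => h.z₃_eq s hs) (h.z₃_eq t ht)).congr_deriv ?_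
    simp only [Pi.mul_apply, weightedSqIntegral]
    rw [e₁, e₂, e₃]
    generalize a t = a at *
    generalize b t = b at *
    field_simp
    ring

theorem momentum_eq (h : IsReducedDP T m₁ m₂ m₃ a b z₁ z₂ z₃) {t : ℝ} (ht : t ∈ Ico 0 T) :
    m₁ t + m₂ t + m₃ t = m₁ 0 + m₂ 0 + m₃ 0 := by
  refine eq_of_hasDerivWithinAt_Ico_zero (f := fun t => m₁ t + m₂ t + m₃ t) (fun s hs => ?_) ht
  refine (((h.deriv_m₁ s hs).add (h.deriv_m₂ s hs)).add (h.deriv_m₃ s hs)).congr_deriv ?_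
  ring

theorem cubic_eq (h : IsReducedDP T m₁ m₂ m₃ a b z₁ z₂ z₃) {t : ℝ} (ht : t ∈ Ico 0 T) :
    m₁ t * m₂ t * m₃ t * ((1 - a t) * (1 - b t)) ^ 2 =
      m₁ 0 * m₂ 0 * m₃ 0 * ((1 - a 0) * (1 - b 0)) ^ 2 := by
  refine eq_of_hasDerivWithinAt_Ico_zero
    (f := fun t => m₁ t * m₂ t * m₃ t * ((1 - a t) * (1 - b t)) ^ 2) (fun s hs => ?_) ht
  refine ((((h.deriv_m₁ s hs).mul (h.deriv_m₂ s hs)).mul (h.deriv_m₃ s hs)).mul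
    ((((h.deriv_a s hs).const_sub 1).mul ((h.deriv_b s hs).const_sub 1)).pow 2)).congr_deriv ?_
  simp only [Pi.mul_apply, Pi.pow_apply]
  rw [h.z₁_eq s hs, h.z₂_eq s hs, h.z₃_eq s hs]
  push_cast
  ring

theorem energy_eq (h : IsReducedDP T m₁ m₂ m₃ a b z₁ z₂ z₃) {t : ℝ} (ht : t ∈ Ico 0 T) :
    dpEnergy (m₁ t) (m₂ t) (m₃ t) (a t) (b t) =
      dpEnergy (m₁ 0) (m₂ 0) (m₃ 0) (a 0) (b 0) := by
  refine eq_of_hasDerivWithinAt_Ico_zero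
    (f := fun t => dpEnergy (m₁ t) (m₂ t) (m₃ t) (a t) (b t)) (fun s hs => ?_) ht
  have d₁ := h.deriv_m₁ s hs
  have d₂ := h.deriv_m₂ s hs
  have d₃ := h.deriv_m₃ s hs
  have da := h.deriv_a s hs
  have db := h.deriv_b s hs
  have dab := da.mul db
  refine ((((((d₁.pow 2).add (d₂.pow 2)).add (d₃.pow 2)).add (((d₁.const_mul 2).mul d₂).mul
    ((da.const_mul 2).sub (da.pow 2)))).add (((d₂.const_mul 2).mul d₃).mul
    ((db.const_mul 2).sub (db.pow 2)))).add (((d₁.const_mul 2).mul d₃).mul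
    ((dab.const_mul 2).sub (dab.pow 2)))).congr_deriv ?_
  simp only [Pi.mul_apply, Pi.pow_apply, Pi.sub_apply]
  rw [h.z₁_eq s hs, h.z₂_eq s hs, h.z₃_eq s hs]
  push_cast
  ring

theorem exists_bound_and_tendsto_z (h : IsReducedDP T m₁ m₂ m₃ a b z₁ z₂ z₃) (hT : 0 < T) :
    ((∃ B, ∀ t ∈ Ico 0 T, |z₁ t| ≤ B) ∧ ∃ l, Tendsto z₁ (𝓝[<] T) (𝓝 l)) ∧
      ((∃ B, ∀ t ∈ Ico 0 T, |z₂ t| ≤ B) ∧ ∃ l, Tendsto z₂ (𝓝[<] T) (𝓝 l)) ∧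
      (∃ B, ∀ t ∈ Ico 0 T, |z₃ t| ≤ B) ∧ ∃ l, Tendsto z₃ (𝓝[<] T) (𝓝 l) := by
  set H := dpEnergy (m₁ 0) (m₂ 0) (m₃ 0) (a 0) (b 0)
  have hbound := fun t (ht : t ∈ Ico 0 T) => abs_le_dpEnergy (m₁ t) (m₂ t) (m₃ t)
    (h.a_mem t ht).1 (h.a_mem t ht).2 (h.b_mem t ht).1 (h.b_mem t ht).2 (h.z₁_eq t ht)
    (h.z₂_eq t ht) (h.z₃_eq t ht)
  have hscale : ∀ {c t : ℝ}, t ∈ Ico 0 T →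
      |c| ≤ 100 * dpEnergy (m₁ t) (m₂ t) (m₃ t) (a t) (b t) → |-(3 / 4) * c| ≤ 75 * H := by
    intro c t ht hc
    rw [h.energy_eq ht] at hc
    rw [abs_mul, abs_neg, abs_of_pos (by norm_num : (0 : ℝ) < 3 / 4)]
    linarith
  exact ⟨exists_bound_and_tendsto_of_abs_deriv_le hT (fun t ht => (h.deriv_z ht).1)
      fun t ht => hscale ht (hbound t ht).1,
    exists_bound_and_tendsto_of_abs_deriv_le hT (fun t ht => (h.deriv_z ht).2.1)
      fun t ht => hscale ht (hbound t ht).2.1,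
    exists_bound_and_tendsto_of_abs_deriv_le hT (fun t ht => (h.deriv_z ht).2.2)
      fun t ht => hscale ht (hbound t ht).2.2⟩

end IsReducedDP

/-! ### Asymptotics at the collision -/

/-- Asymptotics of the masses at a collision of the first two peakons: as `a → 1`, conservation of
the momentum and of the cubic invariant `k ≠ 0` forces `b` to stay away from `1`, the mass `m₃` and
hence `m₁ + m₂` to converge, and `m₁ * (1 - a)` to have the nonzero limit `(Z₁ - Z₂) / 2`. -/
theorem mass_asymptotics_of_collision {ι : Type*} {l : Filter ι} [l.NeBot]
    {m₁ m₂ m₃ a b z₁ z₂ z₃ : ι → ℝ} {p k β Z₁ Z₂ Z₃ : ℝ}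
    (ha : ∀ᶠ t in l, a t ∈ Ioo 0 1) (hb : ∀ᶠ t in l, b t ∈ Ioo 0 1)
    (hz₁ : ∀ᶠ t in l, z₁ t = m₁ t + m₂ t * a t + m₃ t * (a t * b t))
    (hz₂ : ∀ᶠ t in l, z₂ t = m₁ t * a t + m₂ t + m₃ t * b t)
    (hz₃ : ∀ᶠ t in l, z₃ t = m₁ t * (a t * b t) + m₂ t * b t + m₃ t)
    (hp : ∀ᶠ t in l, m₁ t + m₂ t + m₃ t = p)
    (hk : ∀ᶠ t in l, m₁ t * m₂ t * m₃ t * ((1 - a t) * (1 - b t)) ^ 2 = k) (hk0 : k ≠ 0)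
    (hal : Tendsto a l (𝓝 1)) (hbl : Tendsto b l (𝓝 β))
    (hZ₁ : Tendsto z₁ l (𝓝 Z₁)) (hZ₂ : Tendsto z₂ l (𝓝 Z₂)) (hZ₃ : Tendsto z₃ l (𝓝 Z₃)) :
    Z₁ - Z₂ ≠ 0 ∧ Tendsto (fun t => m₁ t * (1 - a t)) l (𝓝 ((Z₁ - Z₂) / 2)) ∧
      ∃ M, Tendsto (fun t => m₁ t + m₂ t) l (𝓝 M) := by
  have hβ : 0 ≤ β := ge_of_tendsto hbl (hb.mono fun t ht => ht.1.le)
  have h1 : Tendsto (fun t => m₁ t * (1 - a t)) l (𝓝 ((Z₁ - Z₂) / 2)) := by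
    have := (hZ₁.sub (hal.mul hZ₂)).div (hal.const_add 1) (by norm_num)
    rw [one_mul, one_add_one_eq_two] at this
    refine this.congr' ?_
    filter_upwards [ha, hz₁, hz₂] with t ht e₁ e₂
    have : 1 + a t ≠ 0 := by linarith [ht.1]
    simp only [Pi.div_apply]
    rw [div_eq_iff this, e₁, e₂]
    ring
  have h3 : Tendsto (fun t => m₃ t * (1 - b t)) l (𝓝 ((Z₃ - β * Z₂) / (1 + β))) := by
    refine ((hZ₃.sub (hbl.mul hZ₂)).div (hbl.const_add 1) (by linarith)).congr' ?_
    filter_upwards [hb, hz₂, hz₃] with t ht e₂ e₃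
    have : 1 + b t ≠ 0 := by linarith [ht.1]
    simp only [Pi.div_apply]
    rw [div_eq_iff this, e₂, e₃]
    ring
  set Q := (Z₃ - β * Z₂) / (1 + β)
  have h2 : Tendsto (fun t => m₂ t * ((1 - a t) * (1 - b t))) l
      (𝓝 (-((Z₁ - Z₂) / 2 * (1 - β)))) := by
    have := ((hZ₂.mul ((hal.const_sub 1).mul (hbl.const_sub 1))).sub
      ((hal.mul h1).mul (hbl.const_sub 1))).sub ((hbl.mul h3).mul (hal.const_sub 1))
    rw [show Z₂ * ((1 - 1) * (1 - β)) - 1 * ((Z₁ - Z₂) / 2) * (1 - β) - β * Q * (1 - 1) =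
      -((Z₁ - Z₂) / 2 * (1 - β)) by ring] at this
    refine this.congr' ?_
    filter_upwards [hz₂] with t e₂
    rw [e₂]
    ring
  -- The invariant factors as m₁(1 - a) · m₃(1 - b) · m₂(1 - a)(1 - b), and each factor has a limit.
  have hkl : (Z₁ - Z₂) / 2 * Q * -((Z₁ - Z₂) / 2 * (1 - β)) = k := by
    refine tendsto_nhds_unique ((h1.mul h3).mul h2) (tendsto_const_nhds.congr' ?_)
    filter_upwards [hk] with t e
    rw [← e]
    ring
  have hs : Z₁ - Z₂ ≠ 0 := fun h => hk0 (by rw [← hkl, h]; ring)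
  have hβ1 : 1 - β ≠ 0 := fun h => hk0 (by rw [← hkl, h]; ring)
  refine ⟨hs, h1, p - Q / (1 - β), ?_⟩
  refine ((h3.div (hbl.const_sub 1) hβ1).const_sub p).congr' ?_
  filter_upwards [hb, hp] with t ht e
  have : 1 - b t ≠ 0 := by linarith [ht.2]
  simp only [Pi.div_apply]
  rw [mul_div_cancel_right₀ _ this, ← e]
  ring

theorem tendsto_div_one_sub_exp_neg {ι : Type*} {l : Filter ι} {r : ι → ℝ}
    (hr : Tendsto r l (𝓝 0)) (hr0 : ∀ᶠ t in l, r t ≠ 0) :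
    Tendsto (fun t => r t / (1 - Real.exp (-r t))) l (𝓝 1) := by
  have h : HasDerivAt (fun s : ℝ => -Real.exp (-s)) 1 0 := by
    simpa using (hasDerivAt_neg (0 : ℝ)).exp.fun_neg
  have h' := (h.tendsto_slope.comp (tendsto_nhdsWithin_iff.2 ⟨hr, hr0⟩)).inv₀ one_ne_zero
  rw [inv_one] at h'
  refine h'.congr fun t => ?_
  simp only [Function.comp, slope_def_field, neg_zero, Real.exp_zero, sub_zero, inv_div]
  congr 1
  ring

theorem theorem3 (x m : ℝ → Fin 3 → ℝ) (tc : ℝ) (htc : 0 < tc)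
    (hsol : IsDPMultipeakon tc x m) (hm : ∀ i, m 0 i ≠ 0) (j : Fin 2)
    (hcoll : Tendsto (fun t => x t j.succ - x t j.castSucc) (𝓝[<] tc) (𝓝 0)) :
    ∃ xc M s : ℝ,
      Tendsto (fun t => x t j.castSucc) (𝓝[<] tc) (𝓝 xc) ∧
      Tendsto (fun t => x t j.succ) (𝓝[<] tc) (𝓝 xc) ∧
      Tendsto (fun t => m t j.castSucc + m t j.succ) (𝓝[<] tc) (𝓝 M) ∧
      Tendsto (fun t => peakonField (x t) (m t) (x t j.castSucc) -
        peakonField (x t) (m t) (x t j.succ)) (𝓝[<] tc) (𝓝 s) ∧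
      s ≠ 0 ∧
      Tendsto (fun t => m t j.castSucc • diracDelta (x t j.castSucc) +
          m t j.succ • diracDelta (x t j.succ)) (𝓝[<] tc)
        (𝓝 (M • diracDelta xc + ((1 / 2 : ℝ) * s) • ∂_{(1 : ℝ)} (diracDelta xc))) := by
  have h := hsol.isReducedDP
  obtain ⟨⟨⟨B₁, hB₁⟩, Z₁, hZ₁⟩, ⟨⟨B₂, hB₂⟩, Z₂, hZ₂⟩, ⟨B₃, hB₃⟩, Z₃, hZ₃⟩ :=
    h.exists_bound_and_tendsto_z htc
  have hpos := fun (k : Fin 3) t (ht : t ∈ Ico 0 tc) => hsol.deriv_position t ht k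
  obtain ⟨-, X₁, hX₁⟩ := exists_bound_and_tendsto_of_abs_deriv_le htc (hpos 0) hB₁
  obtain ⟨-, X₂, hX₂⟩ := exists_bound_and_tendsto_of_abs_deriv_le htc (hpos 1) hB₂
  obtain ⟨-, X₃, hX₃⟩ := exists_bound_and_tendsto_of_abs_deriv_le htc (hpos 2) hB₃
  have hev : ∀ᶠ t in 𝓝[<] tc, t ∈ Ico 0 tc := Ico_mem_nhdsLT htc
  have h0 : (0 : ℝ) ∈ Ico 0 tc := ⟨le_rfl, htc⟩
  have ha0 := h.a_mem 0 h0
  have hb0 := h.b_mem 0 h0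
  have hal : Tendsto (fun t => Real.exp (x t 0 - x t 1)) (𝓝[<] tc) (𝓝 (Real.exp (X₁ - X₂))) :=
    (Real.continuous_exp.tendsto _).comp (hX₁.sub hX₂)
  have hbl : Tendsto (fun t => Real.exp (x t 1 - x t 2)) (𝓝[<] tc) (𝓝 (Real.exp (X₂ - X₃))) :=
    (Real.continuous_exp.tendsto _).comp (hX₂.sub hX₃)
  have hk0 : m 0 0 * m 0 1 * m 0 2 *
      ((1 - Real.exp (x 0 0 - x 0 1)) * (1 - Real.exp (x 0 1 - x 0 2))) ^ 2 ≠ 0 :=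
    mul_ne_zero (mul_ne_zero (mul_ne_zero (hm 0) (hm 1)) (hm 2))
      (pow_ne_zero 2 (mul_ne_zero (sub_ne_zero.2 ha0.2.ne') (sub_ne_zero.2 hb0.2.ne')))
  fin_cases j
  · change Tendsto (fun t => x t 1 - x t 0) (𝓝[<] tc) (𝓝 0) at hcoll
    have hXX : X₂ = X₁ := sub_eq_zero.1 (tendsto_nhds_unique (hX₂.sub hX₁) hcoll)
    subst hXX
    rw [sub_self, Real.exp_zero] at hal
    obtain ⟨hs, hdip, M, hM⟩ := mass_asymptotics_of_collision (hev.mono h.a_mem)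
      (hev.mono h.b_mem) (hev.mono h.z₁_eq) (hev.mono h.z₂_eq) (hev.mono h.z₃_eq)
      (hev.mono fun t ht => h.momentum_eq ht) (hev.mono fun t ht => h.cubic_eq ht) hk0
      hal hbl hZ₁ hZ₂ hZ₃
    refine ⟨X₂, M, Z₁ - Z₂, hX₁, hX₂, hM, hZ₁.sub hZ₂, hs,
      tendsto_smul_diracDelta_add hX₁ hX₂ hM ?_⟩
    have hne : ∀ᶠ t in 𝓝[<] tc, x t 1 - x t 0 ≠ 0 :=
      hev.mono fun t ht => sub_ne_zero.2 (hsol.ordered t ht (by decide)).ne'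
    have := hdip.mul (tendsto_div_one_sub_exp_neg hcoll hne)
    rw [show (Z₁ - Z₂) / 2 * 1 = 1 / 2 * (Z₁ - Z₂) by ring] at this
    refine this.congr' ?_
    filter_upwards [hev] with t ht
    have : 1 - Real.exp (x t 0 - x t 1) ≠ 0 := sub_ne_zero.2 (h.a_mem t ht).2.ne'
    rw [neg_sub, mul_assoc, mul_div_cancel₀ _ this]
    rfl
  · change Tendsto (fun t => x t 2 - x t 1) (𝓝[<] tc) (𝓝 0) at hcoll
    have hXX : X₃ = X₂ := sub_eq_zero.1 (tendsto_nhds_unique (hX₃.sub hX₂) hcoll)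
    subst hXX
    rw [sub_self, Real.exp_zero] at hbl
    -- The asymptotics are purely algebraic, so reversing the labels handles the other pair; the
    -- dipole moment, now measured from x₃ to x₂, changes sign.
    obtain ⟨hs, hdip, M, hM⟩ := mass_asymptotics_of_collision (m₁ := fun t => m t 2)
      (m₂ := fun t => m t 1) (m₃ := fun t => m t 0) (hev.mono h.b_mem)
      (hev.mono h.a_mem)
      (hev.mono fun t ht => (h.z₃_eq t ht).trans (by ring))
      (hev.mono fun t ht => (h.z₂_eq t ht).trans (by ring))
      (hev.mono fun t ht => (h.z₁_eq t ht).trans (by ring))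
      (hev.mono fun t ht => (show _ = _ by ring).trans (h.momentum_eq ht))
      (hev.mono fun t ht => (show _ = _ by ring).trans (h.cubic_eq ht)) hk0
      hbl hal hZ₃ hZ₂ hZ₁
    have hM' := hM.congr fun t => add_comm (m t 2) (m t 1)
    refine ⟨X₃, M, Z₂ - Z₃, hX₂, hX₃, hM', hZ₂.sub hZ₃, fun e => hs (by linarith), ?_⟩
    refine (tendsto_smul_diracDelta_add hX₃ hX₂ hM (σ := 1 / 2 * (Z₂ - Z₃)) ?_).congr
      fun t => add_comm _ _
    have hne : ∀ᶠ t in 𝓝[<] tc, x t 2 - x t 1 ≠ 0 :=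
      hev.mono fun t ht => sub_ne_zero.2 (hsol.ordered t ht (by decide)).ne'
    have := (hdip.mul (tendsto_div_one_sub_exp_neg hcoll hne)).neg
    rw [show -((Z₃ - Z₂) / 2 * 1) = 1 / 2 * (Z₂ - Z₃) by ring] at this
    refine this.congr' ?_
    filter_upwards [hev] with t ht
    have : 1 - Real.exp (x t 1 - x t 2) ≠ 0 := sub_ne_zero.2 (h.b_mem t ht).2.ne'
    rw [neg_sub, mul_assoc, mul_div_cancel₀ _ this]
    ring
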